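/- Let $p\ge 2$ be an integer. Write $\mathbb T=\mathbb R/\mathbb Z$ and, for $m\in\mathbb Z$, $T_m:\mathbb T\to\mathbb T$, $x\mapsto mx \bmod 1$. Let $\mathcal P_p(\mathbb T)$ be the space of $T_p$-invariant Borel probability measures on $\mathbb T$, with the weak-star topology, and let $\mathrm{Leb}$ be the normalised Lebesgue measure. For an integer $m\ge 0$ let $$\psi(m)=R_0(m)+R_{p-1}(m)+N(m),$$ where, in the base-$p$ expansion of $m$, $R_0(m)$ is the number of maximal blocks of $0$s, $R_{p-1}(m)$ is the number of maximal blocks of $(p-1)$s, and $N(m)$ is the number of digits other than $0$ and $p-1$ (with $\psi(0)=0$); for $m<0$ put $\psi(m)=\psi(|m|)$. Let $(c_n)_{n\ge 0}$ be a sequence of integers such that for every $a\in\mathbb Z\setminus\{0\}$ the sequence $(\psi(ac_n))_{n\ge 0}$ tends to infinity along a set of density $1$, i.e. for every $K$ the set $\{n\ge1:\psi(ac_n)\ge K\}$ has natural density $1$. Then the set of all measures $\mu\in\mathcal P_p(\mathbb T)$ which are continuous (have no atoms) and satisfy $T_{c_n}\mu\to\mathrm{Leb}$ weak-star along a set of upper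 density $1$, i.e. for every weak-star neighbourhood $V$ of $\mathrm{Leb}$ in the space of Borel probability measures on $\mathbb T$, $$\limsup_{N\to\infty}\frac1N\,\#\{1\le n\le N: T_{c_n}\mu\in V\}=1,$$ is residual in $\mathcal P_p(\mathbb T)$, i.e. contains a countable intersection of dense open subsets of $\mathcal P_p(\mathbb T)$. -/

import Mathlib

open MeasureTheory Filter Topology

noncomputable section

namespace TimesP

/-- The map `T_m : x ↦ m x mod 1` of the circle `ℝ / ℤ`. -/
def timesMap (m : ℤ) (x : UnitAddCircle) : UnitAddCircle := m • x

theorem measurable_timesMap (m : ℤ) : Measurable (timesMap m) :=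
  (continuous_zsmul m).measurable

/-- The image measure `T_m μ`. -/
def push (m : ℤ) (μ : ProbabilityMeasure UnitAddCircle) : ProbabilityMeasure UnitAddCircle :=
  μ.map (measurable_timesMap m).aemeasurable

/-- The normalised Lebesgue measure on the circle. -/
def leb : ProbabilityMeasure UnitAddCircle :=
  ⟨volume, ⟨UnitAddCircle.measure_univ⟩⟩

/-- The space of `T_p`-invariant Borel probability measures on the circle. As a subtype of
`ProbabilityMeasure UnitAddCircle` it carries the topology of weak-star convergence. -/
abbrev InvMeasure (p : ℕ) : Type :=
  {μ : ProbabilityMeasure UnitAddCircle // push (p : ℤ) μ = μ}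

/-- The proportion of elements of `A` among `1, …, N`. -/
def proportion (A : Set ℕ) (N : ℕ) : ℝ :=
  ((A ∩ Set.Icc 1 N).ncard : ℝ) / N

/-- `A` has natural density `1`. -/
def HasDensityOne (A : Set ℕ) : Prop :=
  Tendsto (proportion A) atTop (𝓝 1)

/-- `A` has upper density `1`. -/
def HasUpperDensityOne (A : Set ℕ) : Prop :=
  limsup (proportion A) atTop = 1

/-- `ν n → ν₀` along a set of upper density `1`: every neighbourhood `V` of `ν₀` contains `ν n`
for all `n` in a set of upper density `1`. -/
def TendstoAlongUpperDensityOne {X : Type*} [TopologicalSpace X] (ν : ℕ → X) (ν₀ : X) : Prop :=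
  ∀ V ∈ 𝓝 ν₀, HasUpperDensityOne {n : ℕ | ν n ∈ V}

/-- `u n → +∞` along a set of density `1`: for every `K`, `u n ≥ K` for all `n` in a set of
density `1`. -/
def TendstoInftyAlongDensityOne (u : ℕ → ℕ) : Prop :=
  ∀ K : ℕ, HasDensityOne {n : ℕ | K ≤ u n}

/-- The number of maximal blocks of the letter `d` in the word `w`. A block is counted through its
last position. -/
def numBlocks (d : ℕ) (w : List ℕ) : ℕ :=
  ((Finset.range w.length).filter fun i => w[i]? = some d ∧ w[i + 1]? ≠ some d).card

/-- The base-`p` digit complexity: the number of maximal blocks of `0`s, plus the number of maximal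
blocks of `(p - 1)`s, plus the number of other digits. -/
def digitComplexity (p m : ℕ) : ℕ :=
  numBlocks 0 (p.digits m) + numBlocks (p - 1) (p.digits m) +
    (p.digits m).countP fun x => x ≠ 0 ∧ x ≠ p - 1

/-- The set of continuous `T_p`-invariant probability measures `μ` such that `T_{c n} μ → Leb`
along a set of upper density `1`. -/
def goodMeasures (p : ℕ) (c : ℕ → ℤ) : Set (InvMeasure p) :=
  {μ | (∀ x : UnitAddCircle, (μ.1 : Measure UnitAddCircle) {x} = 0) ∧
    TendstoAlongUpperDensityOne (fun n => push (c n) μ.1) leb}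

end TimesP

end

noncomputable section

namespace TimesP

/-! This is a Baire category argument. `goodMeasures` contains the countable intersection of the
sets `nearLebOften`. Each of these is open, since its condition for a fixed `N` involves only
finitely many continuous maps `push (c n)`. Points of the intersection have no atoms: an atom of `μ`
survives with at least its mass in every `T_{c n} μ`, while measures near Lebesgue have uniformly
small atoms.

Density rests on `exists_mem_fourierBox`: every invariant `μ` is approximated by invariant `ν` whose
coefficient at `m` tends to `0` as the digit complexity of `m` grows. For such `ν`, the coefficient
of `T_{c n} ν` at `a ≠ 0` is that of `ν` at `a * c n`, so the hypothesis gives convergence to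
Lebesgue along density one.

To build `ν`, let `P = p ^ L`, take the law of the first base-`P` digit under `μ`, and add small
masses at the digits `0` and `1`. Draw all base-`P` digits independently from this law, then average
the images under `T_{p ^ i}`, `i < L`, to recover `T_p`-invariance. The characteristic function is
an infinite product. The added masses put a factor uniformly below `1` in modulus wherever `t / P ^
(k + 1)` is far from the integers, and digit complexity bounds the number of such `k` from below. -/

/-! ### Fourier coefficients and the weak-star topology. -/

/-- The `m`-th Fourier coefficient of a probability measure on the circle. -/
def fourierMass (μ : ProbabilityMeasure UnitAddCircle) (m : ℤ) : ℂ :=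
  ∫ x, fourier m x ∂(μ : Measure UnitAddCircle)

theorem integrable_continuousMap (μ : Measure UnitAddCircle) [IsFiniteMeasure μ]
    (f : C(UnitAddCircle, ℂ)) : Integrable f μ :=
  f.continuous.integrable_of_hasCompactSupport (HasCompactSupport.of_compactSpace f)

theorem norm_integral_sub_le (μ : ProbabilityMeasure UnitAddCircle) (f g : C(UnitAddCircle, ℂ)) :
    ‖∫ x, f x ∂(μ : Measure UnitAddCircle) - ∫ x, g x ∂(μ : Measure UnitAddCircle)‖
      ≤ dist f g := by
  rw [← integral_sub (integrable_continuousMap _ f) (integrable_continuousMap _ g)]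
  refine (norm_integral_le_of_norm_le_const (C := dist f g) (ae_of_all _ fun x => ?_)).trans ?_
  · rw [← dist_eq_norm]
    exact ContinuousMap.dist_apply_le_dist x
  · simp

/-- Weak-star convergence of probability measures on the circle is convergence of all Fourier
coefficients. -/
theorem tendsto_iff_fourierMass {γ : Type*} {F : Filter γ}
    {μs : γ → ProbabilityMeasure UnitAddCircle} {μ : ProbabilityMeasure UnitAddCircle} :
    Tendsto μs F (𝓝 μ) ↔ ∀ m, Tendsto (fun i => fourierMass (μs i) m) F (𝓝 (fourierMass μ m)) := by
  rw [ProbabilityMeasure.tendsto_iff_forall_integral_rclike_tendsto ℂ]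
  refine ⟨fun h m => h (BoundedContinuousFunction.mkOfCompact (fourier m)), fun h f => ?_⟩
  have hspan : ∀ g ∈ Submodule.span ℂ (Set.range (@fourier 1)),
      Tendsto (fun i => ∫ x, g x ∂(μs i : Measure UnitAddCircle)) F
        (𝓝 (∫ x, g x ∂(μ : Measure UnitAddCircle))) := by
    intro g hg
    induction hg using Submodule.span_induction with
    | mem g hg =>
      obtain ⟨m, rfl⟩ := hg
      exact h m
    | zero => simpa using tendsto_const_nhds
    | add g₁ g₂ _ _ h₁ h₂ =>
      simp only [ContinuousMap.add_apply]
      simp_rw [fun ν : ProbabilityMeasure UnitAddCircle => integral_add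
        (integrable_continuousMap (ν : Measure UnitAddCircle) g₁) (integrable_continuousMap _ g₂)]
      exact h₁.add h₂
    | smul a g _ hg =>
      simp only [ContinuousMap.smul_apply, integral_smul]
      exact hg.const_smul a
  rw [Metric.tendsto_nhds]
  intro ε hε
  -- Trigonometric polynomials are uniformly dense, and integration against a probability measure is
  -- 1-Lipschitz, so an `ε / 3` argument suffices.
  have hf : f.toContinuousMap ∈ closure (Submodule.span ℂ (Set.range (@fourier 1)) : Set _) := by
    rw [← Submodule.topologicalClosure_coe, span_fourier_closure_eq_top]
    trivial
  obtain ⟨g, hg, hfg⟩ := Metric.mem_closure_iff.1 hf (ε / 3) (by positivity)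
  filter_upwards [Metric.tendsto_nhds.1 (hspan g hg) (ε / 3) (by positivity)] with i hi
  have h1 := norm_integral_sub_le (μs i) f.toContinuousMap g
  have h2 := norm_integral_sub_le μ f.toContinuousMap g
  rw [← dist_eq_norm] at h1 h2
  rw [dist_comm] at h2
  have h3 := dist_triangle4 (∫ x, f.toContinuousMap x ∂(μs i : Measure UnitAddCircle))
    (∫ x, g x ∂(μs i : Measure UnitAddCircle)) (∫ x, g x ∂(μ : Measure UnitAddCircle))
    (∫ x, f.toContinuousMap x ∂(μ : Measure UnitAddCircle))
  change dist (∫ x, f.toContinuousMap x ∂(μs i : Measure UnitAddCircle))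
    (∫ x, f.toContinuousMap x ∂(μ : Measure UnitAddCircle)) < ε
  linarith

theorem continuous_fourierMass (m : ℤ) : Continuous fun μ => fourierMass μ m :=
  continuous_iff_continuousAt.2 fun _ => tendsto_iff_fourierMass.1 tendsto_id m

theorem eq_of_fourierMass_eq {μ ν : ProbabilityMeasure UnitAddCircle}
    (h : ∀ m, fourierMass μ m = fourierMass ν m) : μ = ν :=
  tendsto_nhds_unique (f := fun _ : ℕ => μ) (l := atTop) tendsto_const_nhds
    (tendsto_iff_fourierMass.2 fun m => by rw [h m]; exact tendsto_const_nhds)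

/-- The measures whose Fourier coefficients of index at most `k` are within `1 / (k + 1)` of those
of `μ`. -/
def fourierBox (μ : ProbabilityMeasure UnitAddCircle) (k : ℕ) :
    Set (ProbabilityMeasure UnitAddCircle) :=
  {ν | ∀ m ∈ Finset.Icc (-(k : ℤ)) k, ‖fourierMass ν m - fourierMass μ m‖ < 1 / ((k : ℝ) + 1)}

theorem isOpen_fourierBox (μ : ProbabilityMeasure UnitAddCircle) (k : ℕ) :
    IsOpen (fourierBox μ k) := by
  have : fourierBox μ k = ⋂ m ∈ Finset.Icc (-(k : ℤ)) k,
      {ν | ‖fourierMass ν m - fourierMass μ m‖ < 1 / ((k : ℝ) + 1)} := by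
    ext; simp [fourierBox]
  rw [this]
  exact isOpen_biInter_finset fun m _ =>
    isOpen_lt ((continuous_fourierMass m).sub continuous_const).norm continuous_const

theorem fourierBox_antitone (μ : ProbabilityMeasure UnitAddCircle) : Antitone (fourierBox μ) := by
  intro k l hkl ν hν m hm
  refine (hν m ?_).trans_le (Nat.one_div_le_one_div hkl)
  simp only [Finset.mem_Icc] at hm ⊢
  omega

/-- Otherwise, picking a point of each box outside `V` gives a sequence whose Fourier coefficients
all converge to those of `μ`. With `isOpen_fourierBox`, the boxes form a countable neighbourhood
basis. -/
theorem exists_fourierBox_subset {μ : ProbabilityMeasure UnitAddCircle}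
    {V : Set (ProbabilityMeasure UnitAddCircle)} (hV : V ∈ 𝓝 μ) : ∃ k, fourierBox μ k ⊆ V := by
  by_contra! hcon
  simp only [Set.not_subset] at hcon
  choose ν hν hνV using hcon
  have : Tendsto ν atTop (𝓝 μ) := by
    refine tendsto_iff_fourierMass.2 fun m => tendsto_iff_norm_sub_tendsto_zero.2 ?_
    refine squeeze_zero' (Eventually.of_forall fun _ => norm_nonneg _) ?_
      (tendsto_one_div_add_atTop_nhds_zero_nat (𝕜 := ℝ))
    filter_upwards [eventually_ge_atTop m.natAbs] with k hk
    refine (hν k m ?_).le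
    simp only [Finset.mem_Icc]
    omega
  obtain ⟨k, hk⟩ := (this.eventually hV).exists
  exact hνV k hk

/-! ### Image measures, Lebesgue measure and atoms. -/

theorem continuous_push (m : ℤ) : Continuous (push m) :=
  ProbabilityMeasure.continuous_map (continuous_zsmul m)

theorem fourierMass_push (c a : ℤ) (μ : ProbabilityMeasure UnitAddCircle) :
    fourierMass (push c μ) a = fourierMass μ (a * c) := by
  unfold fourierMass push
  rw [ProbabilityMeasure.toMeasure_map, integral_map (measurable_timesMap c).aemeasurable
    (fourier a).continuous.aestronglyMeasurable]
  simp [timesMap, fourier_apply, mul_smul]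

theorem fourierMass_zero (μ : ProbabilityMeasure UnitAddCircle) : fourierMass μ 0 = 1 := by
  simp [fourierMass]

theorem fourierMass_leb {m : ℤ} (hm : m ≠ 0) : fourierMass leb m = 0 := by
  exact integral_eq_zero_of_add_right_eq_neg (μ := (volume : Measure UnitAddCircle))
    (fourier_add_half_inv_index (T := 1) hm one_pos)

/-- Measures close to Lebesgue measure have only small atoms. -/
theorem eventually_forall_singleton_lt {a : ENNReal} (ha : 0 < a) :
    ∀ᶠ ν : ProbabilityMeasure UnitAddCircle in 𝓝 leb,
      ∀ x, (ν : Measure UnitAddCircle) {x} < a := by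
  obtain ⟨r, hr, hra⟩ : ∃ r : ℝ, 0 < r ∧ ENNReal.ofReal (2 * r) < a := by
    have h0 : Tendsto (fun r : ℝ => ENNReal.ofReal (2 * r)) (𝓝[>] 0) (𝓝 0) := by
      have : Tendsto (fun r : ℝ => ENNReal.ofReal (2 * r)) (𝓝 0) (𝓝 (ENNReal.ofReal (2 * 0))) :=
        (ENNReal.continuous_ofReal.comp (continuous_const.mul continuous_id)).tendsto 0
      simpa using this.mono_left nhdsWithin_le_nhds
    obtain ⟨r, h1, h2⟩ := ((h0.eventually (gt_mem_nhds ha)).and self_mem_nhdsWithin).exists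
    exact ⟨r, h2, h1⟩
  -- Finitely many balls of Lebesgue measure at most `2 * r` control all points at once; the
  -- portmanteau theorem handles each closed ball.
  obtain ⟨t, -, ht, hcov⟩ := (isCompact_univ (X := UnitAddCircle)).finite_cover_balls hr
  have : ∀ y ∈ t, ∀ᶠ ν : ProbabilityMeasure UnitAddCircle in 𝓝 leb,
      (ν : Measure UnitAddCircle) (Metric.closedBall y r) < a := by
    intro y _
    refine eventually_lt_of_limsup_lt (lt_of_le_of_lt
      (ProbabilityMeasure.limsup_measure_closed_le_of_tendsto (tendsto_id (x := 𝓝 leb))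
        Metric.isClosed_closedBall) (lt_of_le_of_lt ?_ hra))
    change volume (Metric.closedBall y r) ≤ _
    rw [AddCircle.volume_closedBall]
    exact ENNReal.ofReal_le_ofReal (min_le_right _ _)
  filter_upwards [(ht.eventually_all (l := 𝓝 leb)).2 this] with ν hν x
  obtain ⟨y, hy, hxy⟩ := Set.mem_iUnion₂.1 (hcov (Set.mem_univ x))
  exact lt_of_le_of_lt (measure_mono (Set.singleton_subset_iff.2 (Metric.ball_subset_closedBall hxy)))
    (hν y hy)

theorem singleton_le_push (c : ℤ) (μ : ProbabilityMeasure UnitAddCircle) (x : UnitAddCircle) :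
    (μ : Measure UnitAddCircle) {x} ≤ (push c μ : Measure UnitAddCircle) {timesMap c x} := by
  unfold push
  rw [ProbabilityMeasure.toMeasure_map,
    Measure.map_apply (measurable_timesMap c) (measurableSet_singleton _)]
  exact measure_mono (by simp)

/-! ### Characters and characteristic functions. -/

/-- The character `t ↦ exp (2 π i t)`. -/
def expChar (t : ℝ) : ℂ := Real.fourierChar t

theorem expChar_eq (t : ℝ) : expChar t = Complex.exp (Complex.I * ((2 * Real.pi * t : ℝ) : ℂ)) := by
  rw [expChar, Real.fourierChar_apply, mul_comm]

@[simp] theorem norm_expChar (t : ℝ) : ‖expChar t‖ = 1 := Circle.norm_coe _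

@[simp] theorem expChar_zero : expChar 0 = 1 := by simp [expChar]

theorem expChar_add (s t : ℝ) : expChar (s + t) = expChar s * expChar t := by
  simp [expChar, AddChar.map_add_eq_mul]

theorem expChar_sum {ι : Type*} (s : Finset ι) (f : ι → ℝ) :
    expChar (∑ i ∈ s, f i) = ∏ i ∈ s, expChar (f i) := by
  classical
  induction s using Finset.induction_on with
  | empty => simp
  | insert a s ha ih => rw [Finset.sum_insert ha, Finset.prod_insert ha, expChar_add, ih]

theorem continuous_expChar : Continuous expChar :=
  continuous_subtype_val.comp Real.continuous_fourierChar

theorem fourier_coe_eq_expChar (m : ℤ) (x : ℝ) :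
    fourier m (x : UnitAddCircle) = expChar (m * x) := by
  rw [fourier_coe_apply, expChar_eq]
  congr 1
  push_cast
  ring

theorem expChar_eq_toCircle (x : ℝ) :
    expChar x = (AddCircle.toCircle (x : UnitAddCircle) : ℂ) := by
  simpa [fourier_apply] using (fourier_coe_eq_expChar 1 x).symm

theorem expChar_intCast (n : ℤ) : expChar n = 1 := by
  have := fourier_coe_eq_expChar n 1
  rw [mul_one] at this
  rw [← this, AddCircle.coe_period, fourier_eval_zero]

theorem norm_expChar_sub_le (s t : ℝ) : ‖expChar s - expChar t‖ ≤ 2 * Real.pi * |s - t| := by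
  have h : expChar s - expChar t = expChar t * (expChar (s - t) - 1) := by
    rw [mul_sub, ← expChar_add]
    simp
  rw [h, norm_mul, norm_expChar, one_mul, expChar_eq]
  refine Real.norm_exp_I_mul_ofReal_sub_one_le.trans_eq ?_
  rw [Real.norm_eq_abs, abs_mul, abs_of_pos Real.two_pi_pos]

/-- The characteristic function of a real measure, normalised by `2 π`. -/
def charTransform (μ : Measure ℝ) (t : ℝ) : ℂ := ∫ x, expChar (t * x) ∂μ

/-- The characteristic function of a measure on the digits `0, …, P - 1`. -/
def digitTransform {P : ℕ} (q : Measure (Fin P)) (t : ℝ) : ℂ := ∫ b, expChar (t * (b : ℕ)) ∂q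

theorem norm_integral_le_one {α : Type*} [MeasurableSpace α] (μ : Measure α)
    [IsProbabilityMeasure μ] {f : α → ℂ} (hf : ∀ x, ‖f x‖ ≤ 1) : ‖∫ x, f x ∂μ‖ ≤ 1 := by
  simpa using norm_integral_le_of_norm_le_const (μ := μ) (C := 1) (ae_of_all _ hf)

theorem norm_charTransform_le_one (μ : Measure ℝ) [IsProbabilityMeasure μ] (t : ℝ) :
    ‖charTransform μ t‖ ≤ 1 :=
  norm_integral_le_one μ fun _ => (norm_expChar _).le

theorem norm_digitTransform_le_one {P : ℕ} (q : Measure (Fin P)) [IsProbabilityMeasure q] (t : ℝ) :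
    ‖digitTransform q t‖ ≤ 1 :=
  norm_integral_le_one q fun _ => (norm_expChar _).le

theorem digitTransform_intCast {P : ℕ} (q : Measure (Fin P)) [IsProbabilityMeasure q] (n : ℤ) :
    digitTransform q n = 1 := by
  have : ∀ b : Fin P, expChar ((n : ℝ) * (b : ℕ)) = 1 := fun b => by
    exact_mod_cast expChar_intCast (n * (b : ℕ))
  simp [digitTransform, this]

theorem integrable_expChar_mul (μ : Measure ℝ) [IsFiniteMeasure μ] (t : ℝ) :
    Integrable (fun x => expChar (t * x)) μ :=
  .of_bound (continuous_expChar.comp (continuous_const_mul t)).aestronglyMeasurable 1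
    (ae_of_all _ fun _ => (norm_expChar _).le)

theorem norm_charTransform_sub_one_le (μ : Measure ℝ) [IsProbabilityMeasure μ]
    (hμ : ∀ᵐ x ∂μ, x ∈ Set.Icc (0 : ℝ) 1) (t : ℝ) :
    ‖charTransform μ t - 1‖ ≤ 2 * Real.pi * |t| := by
  have h : charTransform μ t - 1 = ∫ x, (expChar (t * x) - 1) ∂μ := by
    rw [integral_sub (integrable_expChar_mul μ t) (integrable_const _)]
    simp [charTransform]
  rw [h]
  refine (norm_integral_le_of_norm_le_const (C := 2 * Real.pi * |t|) ?_).trans_eq (by simp)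
  filter_upwards [hμ] with x hx
  have h1 := norm_expChar_sub_le (t * x) 0
  rw [expChar_zero, sub_zero, abs_mul, abs_of_nonneg hx.1] at h1
  refine h1.trans ?_
  have := mul_le_of_le_one_right (abs_nonneg t) hx.2
  gcongr

/-! ### Independent digits and the infinite product. -/

/-- The law of `∑ B k / P ^ (k + 1)` for independent digits `B k` of law `q`. -/
def digitLaw {P : ℕ} (q : Measure (Fin P)) [IsProbabilityMeasure q] : Measure ℝ :=
  (Measure.infinitePi fun _ : ℕ => q).map Real.ofDigits

theorem measurable_ofDigits {P : ℕ} : Measurable (Real.ofDigits (b := P)) :=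
  Real.continuous_ofDigits.measurable

instance {P : ℕ} (q : Measure (Fin P)) [IsProbabilityMeasure q] :
    IsProbabilityMeasure (digitLaw q) :=
  Measure.isProbabilityMeasure_map measurable_ofDigits.aemeasurable

theorem ae_digitLaw_mem_Icc {P : ℕ} (q : Measure (Fin P)) [IsProbabilityMeasure q] :
    ∀ᵐ x ∂(digitLaw q), x ∈ Set.Icc (0 : ℝ) 1 := by
  refine (ae_map_iff measurable_ofDigits.aemeasurable measurableSet_Icc).2 ?_
  exact ae_of_all _ fun ω => ⟨Real.ofDigits_nonneg _, Real.ofDigits_le_one _⟩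

theorem tendsto_prod_digitTransform {P : ℕ} (q : Measure (Fin P)) [IsProbabilityMeasure q] (t : ℝ) :
    Tendsto (fun K => ∏ k ∈ Finset.range K, digitTransform q (t / (P : ℝ) ^ (k + 1))) atTop
      (𝓝 (charTransform (digitLaw q) t)) := by
  have hsum : ∀ ω : ℕ → Fin P, Tendsto (fun K => expChar (∑ k ∈ Finset.range K,
      t / (P : ℝ) ^ (k + 1) * (ω k : ℕ))) atTop (𝓝 (expChar (t * Real.ofDigits ω))) := by
    intro ω
    refine (continuous_expChar.tendsto _).comp ?_
    have h := ((Real.summable_ofDigitsTerm (digits := ω)).hasSum.tendsto_sum_nat).const_mul t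
    refine h.congr fun K => ?_
    rw [Finset.mul_sum]
    refine Finset.sum_congr rfl fun k _ => ?_
    rw [Real.ofDigitsTerm]
    ring
  have hmeas : ∀ k : ℕ, Measurable fun ω : ℕ → Fin P =>
      expChar (t / (P : ℝ) ^ (k + 1) * ((ω k : Fin P) : ℕ)) := fun k =>
    (measurable_of_finite fun b : Fin P => expChar (t / (P : ℝ) ^ (k + 1) * (b : ℕ))).comp
      (measurable_pi_apply k)
  have hlim : Tendsto (fun K => ∫ ω, expChar (∑ k ∈ Finset.range K,
      t / (P : ℝ) ^ (k + 1) * (ω k : ℕ)) ∂(Measure.infinitePi fun _ : ℕ => q)) atTop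
      (𝓝 (∫ ω, expChar (t * Real.ofDigits ω) ∂(Measure.infinitePi fun _ : ℕ => q))) := by
    refine tendsto_integral_of_dominated_convergence (fun _ => 1) (fun K => ?_)
      (integrable_const _) (fun K => ae_of_all _ fun ω => (norm_expChar _).le) (ae_of_all _ hsum)
    simp_rw [expChar_sum]
    exact (Finset.measurable_fun_prod _ fun k _ => hmeas k).aestronglyMeasurable
  have hmap : charTransform (digitLaw q) t =
      ∫ ω, expChar (t * Real.ofDigits ω) ∂(Measure.infinitePi fun _ : ℕ => q) := by
    rw [charTransform, digitLaw, integral_map measurable_ofDigits.aemeasurable]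
    exact (continuous_expChar.comp (continuous_const_mul t)).aestronglyMeasurable
  rw [hmap]
  refine hlim.congr fun K => ?_
  have hind : ProbabilityTheory.iIndepFun (fun (i : Fin K) (ω : ℕ → Fin P) =>
      expChar (t / (P : ℝ) ^ ((i : ℕ) + 1) * (ω i : ℕ))) (Measure.infinitePi fun _ : ℕ => q) :=
    (ProbabilityTheory.iIndepFun_infinitePi (P := fun _ : ℕ => q)
      (X := fun k b => expChar (t / (P : ℝ) ^ (k + 1) * (b : ℕ)))
      fun _ => measurable_of_finite _).precomp Fin.val_injective
  simp_rw [expChar_sum, Finset.prod_range]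
  rw [hind.integral_fun_prod_eq_prod_integral fun i => (hmeas i).aestronglyMeasurable]
  refine Finset.prod_congr rfl fun i _ => ?_
  rw [digitTransform]
  nth_rw 2 [← Measure.infinitePi_map_eval (fun _ : ℕ => q) (i : ℕ)]
  rw [integral_map (measurable_pi_apply _).aemeasurable
    (measurable_of_finite _).aestronglyMeasurable]

/-- Self-similarity: splitting off the first digit leaves `1 / P` times an independent copy of the
same random number. -/
theorem charTransform_digitLaw {P : ℕ} (q : Measure (Fin P)) [IsProbabilityMeasure q] (t : ℝ) :
    charTransform (digitLaw q) t =
      digitTransform q (t / P) * charTransform (digitLaw q) (t / P) := by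
  refine tendsto_nhds_unique ((tendsto_add_atTop_iff_nat 1).2 (tendsto_prod_digitTransform q t)) ?_
  refine ((tendsto_prod_digitTransform q (t / P)).const_mul (digitTransform q (t / P))).congr
    fun K => ?_
  rw [Finset.prod_range_succ', mul_comm]
  simp [pow_succ', div_div]

/-- The split-off factor is `1` at integers; on the circle this is invariance of the digit law under
`T_P`. -/
theorem charTransform_digitLaw_mul {P : ℕ} (hP : P ≠ 0) (q : Measure (Fin P))
    [IsProbabilityMeasure q] (n : ℤ) :
    charTransform (digitLaw q) (P * n) = charTransform (digitLaw q) n := by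
  rw [charTransform_digitLaw, mul_div_cancel_left₀ _ (Nat.cast_ne_zero.2 hP),
    digitTransform_intCast, one_mul]

theorem norm_charTransform_digitLaw_le_prod {P : ℕ} (q : Measure (Fin P)) [IsProbabilityMeasure q]
    (t : ℝ) (K : ℕ) : ‖charTransform (digitLaw q) t‖ ≤
      ∏ k ∈ Finset.range K, ‖digitTransform q (t / (P : ℝ) ^ (k + 1))‖ := by
  induction K generalizing t with
  | zero => simpa using norm_charTransform_le_one _ t
  | succ K ih =>
    rw [charTransform_digitLaw, norm_mul, Finset.prod_range_succ', mul_comm]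
    refine mul_le_mul ((ih (t / P)).trans_eq ?_) (by simp) (norm_nonneg _)
      (Finset.prod_nonneg fun _ _ => norm_nonneg _)
    simp [pow_succ', div_div]

theorem norm_charTransform_digitLaw_le_pow {P : ℕ} (q : Measure (Fin P)) [IsProbabilityMeasure q]
    {t ρ : ℝ} (s : Finset ℕ)
    (hs : ∀ k ∈ s, ‖digitTransform q (t / (P : ℝ) ^ (k + 1))‖ ≤ ρ) :
    ‖charTransform (digitLaw q) t‖ ≤ ρ ^ s.card := by
  obtain ⟨K, hK⟩ := s.exists_nat_subset_range
  refine (norm_charTransform_digitLaw_le_prod q t K).trans ?_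
  rw [← Finset.prod_sdiff hK]
  refine (mul_le_of_le_one_left (Finset.prod_nonneg fun _ _ => norm_nonneg _)
    (Finset.prod_le_one (fun _ _ => norm_nonneg _)
      fun _ _ => norm_digitTransform_le_one q _)).trans ?_
  exact (Finset.prod_le_prod (fun _ _ => norm_nonneg _) hs).trans_eq (by simp)

/-! ### Digit complexity and distance to the integers. -/

/-- The positions `i` at which the digits number `i` and `i + 1` of `m` are neither both `0` nor
both `p - 1`. -/
def mixedPositions (p m : ℕ) : Finset ℕ :=
  (Finset.range (p.digits m).length).filter fun i =>
    (m / p ^ i) % (p * p) ≠ 0 ∧ (m / p ^ i) % (p * p) + 1 ≠ p * p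

theorem countP_eq_card_filter (w : List ℕ) (f : ℕ → Bool) :
    w.countP f = ((Finset.range w.length).filter fun i => f (w.getD i 0)).card := by
  induction w using List.reverseRecOn with
  | nil => simp
  | append_singleton w a ih =>
    rw [List.countP_append, List.length_append, List.length_singleton, Finset.range_add_one,
      Finset.filter_insert]
    have h : ((Finset.range w.length).filter fun i => f ((w ++ [a]).getD i 0)) =
        (Finset.range w.length).filter fun i => f (w.getD i 0) := by
      refine Finset.filter_congr fun i hi => ?_
      rw [List.getD_append _ _ _ _ (Finset.mem_range.1 hi)]
    rw [h, List.getD_append_right _ _ _ _ le_rfl, ih]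
    by_cases ha : f a <;> simp [ha]

/-- With digits `a`, `b` at `i`, `i + 1`, the residue modulo `p * p` is `a + p * b`. It vanishes
only for `a = b = 0` and equals `p * p - 1` only for `a = b = p - 1`. -/
theorem mem_mixedPositions {p : ℕ} (hp : 2 ≤ p) {m i : ℕ} (hi : i < (p.digits m).length)
    (h0 : ¬ ((p.digits m).getD i 0 = 0 ∧ (p.digits m).getD (i + 1) 0 = 0))
    (h1 : ¬ ((p.digits m).getD i 0 = p - 1 ∧ (p.digits m).getD (i + 1) 0 = p - 1)) :
    i ∈ mixedPositions p m := by
  rw [Nat.getD_digits _ _ hp, Nat.getD_digits _ _ hp, pow_succ, ← Nat.div_div_eq_div_mul] at h0 h1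
  rw [mixedPositions, Finset.mem_filter, Finset.mem_range, Nat.mod_mul]
  have ha : m / p ^ i % p < p := Nat.mod_lt _ (by omega)
  have hb : m / p ^ i / p % p < p := Nat.mod_lt _ (by omega)
  generalize m / p ^ i % p = a at *
  generalize m / p ^ i / p % p = b at *
  refine ⟨hi, fun h => h0 ?_, fun h => h1 ?_⟩
  · have : p * b = 0 := by omega
    rcases Nat.mul_eq_zero.1 this with h' | h' <;> omega
  · obtain ⟨d, hd⟩ := Nat.exists_eq_add_of_lt hb
    rcases Nat.eq_zero_or_pos d with rfl | hd0
    · have : p * p = p * b + p := by rw [hd]; ring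
      omega
    · have : p * (b + 2) ≤ p * p := Nat.mul_le_mul_left _ (by omega)
      rw [mul_add] at this
      omega

/-- The last position of a block of `0`s or of `(p - 1)`s, and the position of any other digit, are
all mixed. Each of the three counts is therefore at most the number of mixed positions. -/
theorem digitComplexity_le {p : ℕ} (hp : 2 ≤ p) (m : ℕ) :
    digitComplexity p m ≤ 3 * (mixedPositions p m).card := by
  have hget : ∀ i < (p.digits m).length, (p.digits m)[i]? = some ((p.digits m).getD i 0) := by
    intro i hi
    rw [List.getD_eq_getElem _ _ hi, List.getElem?_eq_getElem hi]
  have hblock : ∀ i d, (p.digits m)[i + 1]? ≠ some d → i + 1 < (p.digits m).length →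
      (p.digits m).getD (i + 1) 0 ≠ d := fun i d h hi he => h (by rw [hget _ hi, he])
  have hzero : numBlocks 0 (p.digits m) ≤ (mixedPositions p m).card := by
    refine Finset.card_le_card fun i hi => ?_
    simp only [Finset.mem_filter, Finset.mem_range] at hi
    obtain ⟨hi, hd, hn⟩ := hi
    rw [hget i hi, Option.some_inj] at hd
    refine mem_mixedPositions hp hi (fun h => ?_) (fun h => by omega)
    by_cases hi' : i + 1 < (p.digits m).length
    · exact hblock i 0 hn hi' h.2
    -- A block of `0`s cannot end at the top position, because the leading digit is nonzero.
    · have hm : m ≠ 0 := by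
        rintro rfl
        simp at hi
      apply Nat.getLast_digit_ne_zero p hm
      rw [List.getD_eq_getElem _ _ hi] at hd
      rw [List.getLast_eq_getElem]
      convert! hd using 2
      omega
  have hlast : numBlocks (p - 1) (p.digits m) ≤ (mixedPositions p m).card := by
    refine Finset.card_le_card fun i hi => ?_
    simp only [Finset.mem_filter, Finset.mem_range] at hi
    obtain ⟨hi, hd, hn⟩ := hi
    rw [hget i hi, Option.some_inj] at hd
    refine mem_mixedPositions hp hi (fun h => by omega) (fun h => ?_)
    by_cases hi' : i + 1 < (p.digits m).length
    · exact hblock i _ hn hi' h.2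
    -- Beyond the top position the digit defaults to `0`, which differs from `p - 1`.
    · have := h.2
      rw [List.getD_eq_default _ _ (by omega)] at this
      omega
  have hother : ((p.digits m).countP fun x => x ≠ 0 ∧ x ≠ p - 1) ≤ (mixedPositions p m).card := by
    rw [countP_eq_card_filter]
    refine Finset.card_le_card fun i hi => ?_
    simp only [Finset.mem_filter, Finset.mem_range, decide_eq_true_eq] at hi
    exact mem_mixedPositions hp hi.1 (fun h => hi.2.1 h.1) (fun h => hi.2.2 h.1)
  unfold digitComplexity
  omega

theorem le_norm_coe_of_mem_Icc {x δ : ℝ} (n : ℤ) (h₁ : n + δ ≤ x) (h₂ : x ≤ n + 1 - δ) :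
    δ ≤ ‖(x : UnitAddCircle)‖ := by
  rw [UnitAddCircle.norm_eq]
  rcases le_or_gt (round x) n with h | h
  · have : ((round x : ℤ) : ℝ) ≤ n := by exact_mod_cast h
    exact le_trans (by linarith) (le_abs_self _)
  · have : (n : ℝ) + 1 ≤ ((round x : ℤ) : ℝ) := by exact_mod_cast h
    exact le_trans (by linarith) (neg_le_abs _)

theorem le_norm_of_mem_mixedPositions {p m i : ℕ} (hp : 2 ≤ p) (hi : i ∈ mixedPositions p m) :
    1 / (p : ℝ) ^ 2 ≤ ‖(((m : ℝ) / (p : ℝ) ^ (i + 2) : ℝ) : UnitAddCircle)‖ := by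
  obtain ⟨-, h0, h1⟩ := Finset.mem_filter.1 hi
  have hp0 : (0 : ℝ) < p := by exact_mod_cast (by omega : 0 < p)
  have hlt : (m / p ^ i) % (p * p) < p * p := Nat.mod_lt _ (by positivity)
  have hm := Nat.div_add_mod m (p ^ i)
  have hm' := Nat.div_add_mod (m / p ^ i) (p * p)
  have hs : m % p ^ i < p ^ i := Nat.mod_lt _ (by positivity)
  generalize m % p ^ i = s at *
  generalize (m / p ^ i) % (p * p) = e at *
  generalize m / p ^ i / (p * p) = n at *
  rw [← hm'] at hm
  have hmR : (p : ℝ) ^ i * (p * p * n + e) + s = m := by exact_mod_cast hm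
  have he1 : (1 : ℝ) ≤ e := by exact_mod_cast Nat.one_le_iff_ne_zero.2 h0
  have he2 : (e : ℝ) + 2 ≤ p * p := by exact_mod_cast (by omega : e + 2 ≤ p * p)
  have hsR : (s : ℝ) ≤ (p : ℝ) ^ i := by exact_mod_cast hs.le
  have hs0 : (0 : ℝ) ≤ s := Nat.cast_nonneg s
  have hpi : (0 : ℝ) < (p : ℝ) ^ i := by positivity
  -- Since `1 ≤ e ≤ p * p - 2` and `0 ≤ s / p ^ i ≤ 1`, the fractional part stays `1 / p ^ 2` away
  -- from both `0` and `1`.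
  have hx : (m : ℝ) / (p : ℝ) ^ (i + 2) = n + (e + s / (p : ℝ) ^ i) / (p : ℝ) ^ 2 := by
    rw [← hmR, pow_add]
    field_simp
    ring
  have hs1 : (s : ℝ) / (p : ℝ) ^ i ≤ 1 := (div_le_one hpi).2 hsR
  have hs2 : 0 ≤ (s : ℝ) / (p : ℝ) ^ i := by positivity
  refine le_norm_coe_of_mem_Icc (n : ℤ) ?_ ?_ <;> rw [hx, Int.cast_natCast]
  · gcongr
    linarith
  · have : (e + s / (p : ℝ) ^ i) / (p : ℝ) ^ 2 ≤ (p * p - 1) / (p : ℝ) ^ 2 := by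
      gcongr
      linarith
    have h3 : (p * p - 1) / (p : ℝ) ^ 2 = 1 - 1 / (p : ℝ) ^ 2 := by field_simp
    linarith

/-- If `m` has large digit complexity, then many of the numbers `p ^ a * m / p ^ (L * (k + 1))`
are far from the integers. -/
theorem exists_finset_le_norm {p L : ℕ} (hp : 2 ≤ p) (hL : 0 < L) (a : ℕ) (m : ℤ) :
    ∃ s : Finset ℕ, digitComplexity p m.natAbs ≤ 3 * (L * s.card) ∧ ∀ k ∈ s,
      1 / (p : ℝ) ^ (L + 2) ≤
        ‖(((p : ℝ) ^ a * m / ((p ^ L : ℕ) : ℝ) ^ (k + 1) : ℝ) : UnitAddCircle)‖ := by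
  have hp0 : (0 : ℝ) < p := by exact_mod_cast (by omega : 0 < p)
  -- At most `L` mixed positions share the same `k`.
  refine ⟨(mixedPositions p m.natAbs).image fun i => (i + 2 + a) / L, ?_, ?_⟩
  · refine (digitComplexity_le hp _).trans (Nat.mul_le_mul_left 3 ?_)
    refine Finset.card_le_mul_card_image _ L fun b _ => ?_
    have hsub : ((mixedPositions p m.natAbs).filter fun i => (i + 2 + a) / L = b) ⊆
        (Finset.Ico (L * b) (L * b + L)).preimage (fun i => i + (2 + a))
          (add_left_injective _).injOn := by
      intro i hi
      have h := (Finset.mem_filter.1 hi).2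
      have h1 := Nat.div_add_mod (i + 2 + a) L
      have h2 := Nat.mod_lt (i + 2 + a) hL
      rw [h] at h1
      simp only [Finset.mem_preimage, Finset.mem_Ico]
      omega
    refine (Finset.card_le_card hsub).trans ?_
    refine (Finset.card_le_card_of_injOn (t := Finset.Ico (L * b) (L * b + L))
      (fun i => i + (2 + a)) (fun i hi => ?_) (add_left_injective _).injOn).trans (by simp)
    simpa using hi
  · intro k hk
    obtain ⟨i, hi, rfl⟩ := Finset.mem_image.1 hk
    have hnorm := le_norm_of_mem_mixedPositions hp hi
    have h1 := Nat.div_add_mod (i + 2 + a) L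
    have h2 := Nat.mod_lt (i + 2 + a) hL
    set k := (i + 2 + a) / L
    -- Multiplying the point by `p ^ r`, with `r ≤ L`, gives `m / p ^ (i + 2)`. Its norm is thus
    -- smaller by a factor of at most `p ^ L`.
    obtain ⟨r, hr⟩ : ∃ r, L * (k + 1) = i + 2 + a + r :=
      Nat.exists_eq_add_of_le (by rw [mul_add]; omega)
    have hrL : r ≤ L := by rw [mul_add] at hr; omega
    have hsmul : ((((m : ℤ) : ℝ) / (p : ℝ) ^ (i + 2) : ℝ) : UnitAddCircle) =
        (p ^ r) • (((p : ℝ) ^ a * m / ((p ^ L : ℕ) : ℝ) ^ (k + 1) : ℝ) : UnitAddCircle) := by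
      rw [← AddCircle.coe_nsmul, nsmul_eq_mul]
      congr 1
      push_cast
      rw [← pow_mul, hr, pow_add _ (i + 2 + a), pow_add _ (i + 2)]
      field_simp
    have habs : ‖((((m : ℤ) : ℝ) / (p : ℝ) ^ (i + 2) : ℝ) : UnitAddCircle)‖ =
        ‖((((m.natAbs : ℕ) : ℝ) / (p : ℝ) ^ (i + 2) : ℝ) : UnitAddCircle)‖ := by
      have hcast : ((m.natAbs : ℕ) : ℝ) = ((m.natAbs : ℤ) : ℝ) := by simp
      rcases Int.natAbs_eq m with h | h
      · rw [hcast, ← h]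
      · rw [hcast]
        nth_rw 1 [h]
        rw [Int.cast_neg, neg_div, AddCircle.coe_neg, norm_neg]
    rw [← habs, hsmul] at hnorm
    have hle := hnorm.trans (norm_nsmul_le (n := p ^ r))
    have hpr : ((p ^ r : ℕ) : ℝ) ≤ (p : ℝ) ^ L := by
      push_cast
      exact pow_le_pow_right₀ (by exact_mod_cast (by omega : 1 ≤ p)) hrL
    have hle' := hle.trans (mul_le_mul_of_nonneg_right hpr (norm_nonneg _))
    rw [pow_add, mul_comm, ← div_div, div_le_iff₀ (by positivity), mul_comm]
    exact hle'

/-! ### Approximation by invariant measures with Fourier decay. -/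

theorem exists_measurable_digit (P : ℕ) (hP : 0 < P) :
    ∃ B : UnitAddCircle → Fin P, Measurable B ∧
      ∀ y, ∃ x : ℝ, (x : UnitAddCircle) = y ∧ |(B y : ℕ) / (P : ℝ) - x| ≤ 1 / P := by
  have hP' : (0 : ℝ) < P := by exact_mod_cast hP
  let r : UnitAddCircle → ℝ := fun y => AddCircle.measurableEquivIco 1 0 y
  have hr : ∀ y, 0 ≤ r y ∧ r y < 1 := fun y => by
    simpa using (AddCircle.measurableEquivIco 1 0 y).2
  have hmeas : Measurable r :=
    measurable_subtype_coe.comp (AddCircle.measurableEquivIco 1 0).measurable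
  have hlt : ∀ y, ⌊P * r y⌋₊ < P := fun y => by
    rw [Nat.floor_lt (mul_nonneg hP'.le (hr y).1)]
    exact mul_lt_of_lt_one_right hP' (hr y).2
  refine ⟨fun y => ⟨⌊P * r y⌋₊, hlt y⟩, ?_, fun y => ⟨r y, AddCircle.coe_equivIco, ?_⟩⟩
  · refine measurable_to_countable' fun b => ?_
    have : (fun y => (⟨⌊P * r y⌋₊, hlt y⟩ : Fin P)) ⁻¹' {b} =
        (fun y => ⌊P * r y⌋₊) ⁻¹' {(b : ℕ)} := by
      ext y
      simp [Fin.ext_iff]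
    rw [this]
    exact (Nat.measurable_floor.comp (hmeas.const_mul _)) (measurableSet_singleton _)
  · have h1 := Nat.floor_le (mul_nonneg hP'.le (hr y).1)
    have h2 := Nat.lt_floor_add_one (P * r y)
    have : (⌊P * r y⌋₊ : ℝ) / P - r y = (⌊P * r y⌋₊ - P * r y) / P := by field_simp
    change |(⌊P * r y⌋₊ : ℝ) / P - r y| ≤ 1 / P
    rw [this, abs_div, abs_of_pos hP']
    gcongr
    rw [abs_le]
    constructor <;> linarith

/-- A law on the digits whose characteristic function is bounded away from `1` in modulus off the
integers, and which approximates the first digit in base `P` under `μ`. -/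
theorem exists_digit_measure (μ : ProbabilityMeasure UnitAddCircle) {P : ℕ} (hP : 2 ≤ P) {ε : ℝ}
    (hε : 0 ≤ ε) (hε' : 2 * ε ≤ 1) :
    ∃ q : Measure (Fin P), IsProbabilityMeasure q ∧
      (∀ t, ‖digitTransform q t‖ ≤ 1 - 2 * ε + ε * ‖1 + expChar t‖) ∧
      ∀ n : ℤ, ‖digitTransform q (n / P) - fourierMass μ n‖
        ≤ 4 * ε + 2 * Real.pi * (|(n : ℝ)| / P) := by
  obtain ⟨B, hB, hBx⟩ := exists_measurable_digit P (by omega)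
  have hP' : (0 : ℝ) < P := by exact_mod_cast (by omega : 0 < P)
  let q₀ : Measure (Fin P) := (μ : Measure UnitAddCircle).map B
  have hq₀ : IsProbabilityMeasure q₀ := Measure.isProbabilityMeasure_map hB.aemeasurable
  let b₀ : Fin P := ⟨0, by omega⟩
  let b₁ : Fin P := ⟨1, by omega⟩
  -- The masses at `0` and `1` contribute `ε * (1 + expChar t)`, which has modulus below `2 * ε` off
  -- the integers, whatever `q₀` is.
  let q : Measure (Fin P) := ENNReal.ofReal (1 - 2 * ε) • q₀ +
    (ENNReal.ofReal ε • Measure.dirac b₀ + ENNReal.ofReal ε • Measure.dirac b₁)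
  have hq : IsProbabilityMeasure q := by
    refine ⟨?_⟩
    simp only [q, Measure.add_apply, Measure.smul_apply, measure_univ, smul_eq_mul, mul_one]
    rw [← ENNReal.ofReal_add hε hε, ← ENNReal.ofReal_add (by linarith) (by linarith)]
    rw [show 1 - 2 * ε + (ε + ε) = 1 by ring, ENNReal.ofReal_one]
  have htrans : ∀ t, digitTransform q t =
      (1 - 2 * ε : ℝ) * digitTransform q₀ t + ε * (1 + expChar t) := by
    intro t
    have hint : ∀ (ν : Measure (Fin P)) [IsFiniteMeasure ν],
        Integrable (fun b : Fin P => expChar (t * (b : ℕ))) ν := fun ν _ => .of_finite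
    have h1 : ∀ b : Fin P, ∫ x : Fin P, expChar (t * (x : ℕ)) ∂(Measure.dirac b) =
        expChar (t * (b : ℕ)) := fun b => integral_dirac _ _
    have hf : ∀ (ν : Measure (Fin P)) [IsFiniteMeasure ν] (a : ℝ),
        Integrable (fun b : Fin P => expChar (t * (b : ℕ))) (ENNReal.ofReal a • ν) :=
      fun ν _ a => (hint ν).smul_measure ENNReal.ofReal_ne_top
    unfold digitTransform
    simp only [q]
    rw [integral_add_measure (hf _ _) ((hf _ _).add_measure (hf _ _)),
      integral_add_measure (hf _ _) (hf _ _)]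
    simp only [integral_smul_measure, h1]
    rw [ENNReal.toReal_ofReal hε, ENNReal.toReal_ofReal (by linarith)]
    simp only [b₀, b₁, Complex.real_smul]
    simp
    ring
  refine ⟨q, hq, fun t => ?_, fun n => ?_⟩
  · rw [htrans]
    refine (norm_add_le _ _).trans ?_
    rw [norm_mul, norm_mul, Complex.norm_real, Complex.norm_real, Real.norm_of_nonneg hε,
      Real.norm_of_nonneg (by linarith : 0 ≤ 1 - 2 * ε)]
    gcongr
    exact mul_le_of_le_one_right (by linarith) (norm_digitTransform_le_one q₀ t)
  · have hq₀n : ‖digitTransform q₀ (n / P) - fourierMass μ n‖ ≤ 2 * Real.pi * (|(n : ℝ)| / P) := by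
      have hmap : digitTransform q₀ (n / P) =
          ∫ y, expChar (n / P * (B y : ℕ)) ∂(μ : Measure UnitAddCircle) := by
        rw [digitTransform, integral_map hB.aemeasurable
          (measurable_of_finite _).aestronglyMeasurable]
      have hint : Integrable (fun y => expChar (n / P * (B y : ℕ))) (μ : Measure UnitAddCircle) :=
        .of_bound (((measurable_of_finite fun b : Fin P =>
          expChar (n / P * (b : ℕ))).comp hB).aestronglyMeasurable) 1
          (ae_of_all _ fun y => (norm_expChar _).le)
      rw [hmap, fourierMass, ← integral_sub hint (integrable_continuousMap _ _)]
      refine (norm_integral_le_of_norm_le_const (C := 2 * Real.pi * (|(n : ℝ)| / P))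
        (ae_of_all _ fun y => ?_)).trans_eq (by simp)
      obtain ⟨x, rfl, hx⟩ := hBx y
      rw [fourier_coe_eq_expChar]
      refine (norm_expChar_sub_le _ _).trans ?_
      gcongr
      rw [show (n : ℝ) / P * (B x : ℕ) - n * x = n * ((B x : ℕ) / P - x) by ring, abs_mul]
      exact (mul_le_mul_of_nonneg_left hx (abs_nonneg _)).trans_eq (mul_one_div _ _)
    have hdiff : ‖digitTransform q (n / P) - digitTransform q₀ (n / P)‖ ≤ 4 * ε := by
      have h : digitTransform q (n / P) - digitTransform q₀ (n / P) =
          ε * (1 + expChar (n / P) - 2 * digitTransform q₀ (n / P)) := by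
        rw [htrans]
        push_cast
        ring
      rw [h, norm_mul, Complex.norm_real, Real.norm_of_nonneg hε, mul_comm]
      gcongr
      refine (norm_sub_le _ _).trans ?_
      have h1 := norm_add_le (1 : ℂ) (expChar (n / P))
      have h2 := norm_digitTransform_le_one q₀ (n / P)
      rw [norm_one, norm_expChar] at h1
      rw [norm_mul, Complex.norm_ofNat]
      linarith
    linarith [norm_sub_le_norm_sub_add_norm_sub (digitTransform q (n / P))
      (digitTransform q₀ (n / P)) (fourierMass μ n)]

/-- The average of the images of a real measure under `x ↦ p ^ i * x mod 1`, `i < L`. -/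
theorem exists_average (lam : Measure ℝ) [IsProbabilityMeasure lam] (p : ℕ) {L : ℕ} (hL : 0 < L) :
    ∃ ν : ProbabilityMeasure UnitAddCircle, ∀ m : ℤ, fourierMass ν m =
      (1 / (L : ℝ) : ℝ) * ∑ i ∈ Finset.range L, charTransform lam ((p : ℝ) ^ i * m) := by
  have hmeas : ∀ i : ℕ, Measurable fun x : ℝ => (((p : ℝ) ^ i * x : ℝ) : UnitAddCircle) := fun i =>
    AddCircle.measurable_mk'.comp (measurable_const_mul _)
  have hprob : ∀ i, IsProbabilityMeasure
      (lam.map fun x : ℝ => (((p : ℝ) ^ i * x : ℝ) : UnitAddCircle)) :=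
    fun i => Measure.isProbabilityMeasure_map (hmeas i).aemeasurable
  let ν : Measure UnitAddCircle := (L : ENNReal)⁻¹ • ∑ i ∈ Finset.range L,
    lam.map fun x : ℝ => (((p : ℝ) ^ i * x : ℝ) : UnitAddCircle)
  have hν : IsProbabilityMeasure ν := by
    refine ⟨?_⟩
    simp only [ν, Measure.smul_apply, Measure.finsetSum_apply, measure_univ]
    simp [ENNReal.inv_mul_cancel, hL.ne']
  refine ⟨⟨ν, hν⟩, fun m => ?_⟩
  change ∫ x, fourier m x ∂ν = _
  rw [integral_smul_measure, integral_finsetSum_measure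
    fun i _ => integrable_continuousMap _ _, Complex.real_smul]
  congr 1
  · simp
  · refine Finset.sum_congr rfl fun i _ => ?_
    rw [integral_map (hmeas i).aemeasurable (fourier m).continuous.aestronglyMeasurable]
    simp only [fourier_coe_eq_expChar, charTransform]
    refine integral_congr_ae (ae_of_all _ fun x => ?_)
    change expChar _ = expChar _
    congr 1
    ring

/-- By the parallelogram law, `‖1 + z‖ < 2` for unimodular `z ≠ 1`; compactness makes the gap
uniform. -/
theorem exists_norm_one_add_expChar_le {δ : ℝ} (hδ : 0 < δ) :
    ∃ r, 0 ≤ r ∧ r < 2 ∧ ∀ t : ℝ, δ ≤ ‖(t : UnitAddCircle)‖ → ‖1 + expChar t‖ ≤ r := by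
  have hK : IsCompact {x : UnitAddCircle | δ ≤ ‖x‖} :=
    (isClosed_le continuous_const continuous_norm).isCompact
  have hcont : Continuous fun x : UnitAddCircle => ‖1 + (AddCircle.toCircle x : ℂ)‖ :=
    (continuous_const.add (continuous_subtype_val.comp AddCircle.continuous_toCircle)).norm
  rcases Set.eq_empty_or_nonempty {x : UnitAddCircle | δ ≤ ‖x‖} with h | h
  · exact ⟨0, le_rfl, two_pos, fun t ht => absurd ht (Set.eq_empty_iff_forall_notMem.1 h _)⟩
  obtain ⟨x, hx, hmax⟩ := hK.exists_isMaxOn h hcont.continuousOn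
  refine ⟨‖1 + (AddCircle.toCircle x : ℂ)‖, norm_nonneg _, ?_, fun t ht => ?_⟩
  swap
  · rw [expChar_eq_toCircle]
    exact hmax ht
  have hne : (AddCircle.toCircle x : ℂ) ≠ 1 := by
    intro h1
    have : AddCircle.toCircle x = AddCircle.toCircle (0 : UnitAddCircle) := by
      rw [AddCircle.toCircle_zero]
      exact Subtype.ext h1
    rw [AddCircle.injective_toCircle one_ne_zero this] at hx
    simp only [Set.mem_ofPred_eq, norm_zero] at hx
    linarith
  have hpar := parallelogram_law_with_norm ℝ (1 : ℂ) (AddCircle.toCircle x : ℂ)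
  rw [norm_one, Circle.norm_coe] at hpar
  have hpos : 0 < ‖1 - (AddCircle.toCircle x : ℂ)‖ := norm_pos_iff.2 (sub_ne_zero.2 hne.symm)
  nlinarith [norm_nonneg (1 + (AddCircle.toCircle x : ℂ))]

theorem sum_range_pow_le {p : ℕ} (hp : 2 ≤ p) (L : ℕ) :
    ∑ i ∈ Finset.range L, (p : ℝ) ^ i ≤ (p : ℝ) ^ L := by
  have hp' : (2 : ℝ) ≤ p := by exact_mod_cast hp
  induction L with
  | zero => simp
  | succ L ih =>
    rw [Finset.sum_range_succ, pow_succ]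
    nlinarith [pow_pos (by linarith : (0 : ℝ) < p) L]

theorem fourierMass_pow_mul {p : ℕ} {μ : ProbabilityMeasure UnitAddCircle} (hμ : push (p : ℤ) μ = μ)
    (i : ℕ) (m : ℤ) : fourierMass μ ((p : ℤ) ^ i * m) = fourierMass μ m := by
  induction i with
  | zero => simp
  | succ i ih =>
    rw [← ih]
    conv_rhs => rw [← hμ, fourierMass_push]
    congr 1
    ring

/-- Invariant measures whose Fourier coefficients decay with the digit complexity are dense. -/
theorem exists_mem_fourierBox {p : ℕ} (hp : 2 ≤ p) {μ : ProbabilityMeasure UnitAddCircle}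
    (hμ : push (p : ℤ) μ = μ) (k : ℕ) :
    ∃ ν ∈ fourierBox μ k, push (p : ℤ) ν = ν ∧ ∀ η > 0, ∃ K, ∀ m : ℤ,
      K ≤ digitComplexity p m.natAbs → ‖fourierMass ν m‖ < η := by
  have hp0 : (0 : ℝ) < p := by exact_mod_cast (by omega : 0 < p)
  obtain ⟨ε, hε, hε1, hεk⟩ : ∃ ε : ℝ, 0 < ε ∧ 2 * ε ≤ 1 ∧ 4 * ε = 1 / 2 * (1 / ((k : ℝ) + 1)) := by
    refine ⟨1 / 8 * (1 / ((k : ℝ) + 1)), by positivity, ?_, by ring⟩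
    have : 1 / ((k : ℝ) + 1) ≤ 1 := (div_le_one (by positivity)).2 (by linarith [k.cast_nonneg (α := ℝ)])
    linarith
  -- The error splits as `4 * ε`, half the tolerance, plus `4 * π * k / L`, which this choice makes
  -- less than the other half.
  obtain ⟨L, hLgt⟩ := exists_nat_gt (8 * Real.pi * k * (k + 1))
  have hL' : (0 : ℝ) < L := lt_of_le_of_lt (by positivity) hLgt
  have hL : 0 < L := by exact_mod_cast hL'
  have hP : 2 ≤ p ^ L := hp.trans (Nat.le_self_pow hL.ne' p)
  obtain ⟨q, hq, hqdecay, hqapprox⟩ := exists_digit_measure μ hP hε.le hε1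
  obtain ⟨ν, hν⟩ := exists_average (digitLaw q) p hL
  have hcastP : ((p ^ L : ℕ) : ℝ) = (p : ℝ) ^ L := by push_cast; rfl
  refine ⟨ν, fun m hm => ?_, eq_of_fourierMass_eq fun m => ?_, fun η hη => ?_⟩
  · have hmk : |(m : ℝ)| ≤ k := by
      rw [Finset.mem_Icc] at hm
      rw [abs_le]
      exact ⟨by exact_mod_cast hm.1, by exact_mod_cast hm.2⟩
    have hterm : ∀ i ∈ Finset.range L,
        ‖charTransform (digitLaw q) ((p : ℝ) ^ i * m) - fourierMass μ m‖ ≤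
          4 * ε + 4 * Real.pi * k / (p : ℝ) ^ L * (p : ℝ) ^ i := by
      intro i _
      have h1 := hqapprox ((p : ℤ) ^ i * m)
      have h2 := norm_charTransform_sub_one_le (digitLaw q) (ae_digitLaw_mem_Icc q)
        ((p : ℝ) ^ i * m / ((p ^ L : ℕ) : ℝ))
      have h3 := norm_digitTransform_le_one q ((p : ℝ) ^ i * m / ((p ^ L : ℕ) : ℝ))
      rw [fourierMass_pow_mul hμ] at h1
      push_cast at h1 h2 h3
      have habs : |(p : ℝ) ^ i * m| / (p : ℝ) ^ L ≤ k / (p : ℝ) ^ L * (p : ℝ) ^ i := by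
        rw [abs_mul, abs_of_pos (by positivity : (0 : ℝ) < (p : ℝ) ^ i), mul_comm, mul_div_right_comm]
        gcongr
      rw [abs_div, abs_of_pos (by positivity : (0 : ℝ) < (p : ℝ) ^ L)] at h2
      rw [charTransform_digitLaw]
      push_cast
      set φ := digitTransform q ((p : ℝ) ^ i * m / (p : ℝ) ^ L)
      set ψ := charTransform (digitLaw q) ((p : ℝ) ^ i * m / (p : ℝ) ^ L)
      -- The first digit carries the approximation of `μ`; the remaining digits contribute `ψ`,
      -- close to `1`. Both errors grow like `p ^ i / p ^ L`, large only for `i` near `L`, so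
      -- averaging over `i` makes them `O(1 / L)`.
      have h4 : φ * ψ - fourierMass μ m = φ * (ψ - 1) + (φ - fourierMass μ m) := by ring
      have h5 : ‖φ * (ψ - 1)‖ ≤ ‖ψ - 1‖ := by
        rw [norm_mul]
        exact mul_le_of_le_one_left (norm_nonneg _) h3
      rw [h4]
      refine (norm_add_le _ _).trans ?_
      have h6 := mul_le_mul_of_nonneg_left habs Real.two_pi_pos.le
      have h7 : 4 * Real.pi * k / (p : ℝ) ^ L * (p : ℝ) ^ i =
          2 * (2 * Real.pi * (k / (p : ℝ) ^ L * (p : ℝ) ^ i)) := by ring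
      linarith
    have hsum : fourierMass ν m - fourierMass μ m = (1 / (L : ℝ) : ℝ) * ∑ i ∈ Finset.range L,
        (charTransform (digitLaw q) ((p : ℝ) ^ i * m) - fourierMass μ m) := by
      have : (L : ℂ) ≠ 0 := by exact_mod_cast hL.ne'
      rw [hν, Finset.sum_sub_distrib, mul_sub]
      simp [this]
    have hbound : ‖∑ i ∈ Finset.range L,
        (charTransform (digitLaw q) ((p : ℝ) ^ i * m) - fourierMass μ m)‖ ≤
          L * (4 * ε) + 4 * Real.pi * k := by
      refine (norm_sum_le_of_le _ hterm).trans ?_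
      rw [Finset.sum_add_distrib, Finset.sum_const, Finset.card_range, nsmul_eq_mul,
        ← Finset.mul_sum]
      refine add_le_add le_rfl ?_
      calc _ ≤ 4 * Real.pi * k / (p : ℝ) ^ L * (p : ℝ) ^ L := by
            gcongr
            exact sum_range_pow_le hp L
        _ = 4 * Real.pi * k := by field_simp
    rw [hsum, norm_mul, Complex.norm_real, Real.norm_of_nonneg (by positivity), one_div_mul_eq_div,
      div_lt_iff₀ hL']
    refine hbound.trans_lt ?_
    have hkL : 4 * Real.pi * k < 1 / 2 * (1 / ((k : ℝ) + 1)) * L := by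
      have hk1 : (0 : ℝ) < (k : ℝ) + 1 := by positivity
      rw [show 1 / 2 * (1 / ((k : ℝ) + 1)) * L = L / 2 / (k + 1) by ring, lt_div_iff₀ hk1]
      linarith
    rw [hεk]
    linarith
  · rw [fourierMass_push, hν, hν]
    congr 1
    let g : ℕ → ℂ := fun i => charTransform (digitLaw q) ((p : ℝ) ^ i * m)
    -- Applying `T_p` shifts the average by one index, and `T_P`-invariance closes the cycle.
    have hg : g L = g 0 := by
      have := charTransform_digitLaw_mul (by positivity) q m
      rw [hcastP] at this
      simpa [g] using this
    have h1 : ∑ i ∈ Finset.range L, charTransform (digitLaw q) ((p : ℝ) ^ i * ((m * p : ℤ) : ℝ)) =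
        ∑ i ∈ Finset.range L, g (i + 1) := by
      refine Finset.sum_congr rfl fun i _ => ?_
      simp only [g]
      congr 1
      push_cast
      ring
    have h2 := Finset.sum_range_succ g L
    rw [Finset.sum_range_succ', hg] at h2
    rw [h1]
    exact add_right_cancel h2
  · obtain ⟨r, hr0, hr2, hr⟩ := exists_norm_one_add_expChar_le
      (δ := 1 / (p : ℝ) ^ (L + 2)) (by positivity)
    set ρ := 1 - 2 * ε + ε * r
    have hρ0 : 0 ≤ ρ := by nlinarith
    have hρ1 : ρ < 1 := by
      have := mul_lt_mul_of_pos_left hr2 hε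
      simp only [ρ]
      linarith
    obtain ⟨n, hn⟩ := exists_pow_lt_of_lt_one hη hρ1
    refine ⟨3 * (L * n), fun m hm => ?_⟩
    have hterm : ∀ i ∈ Finset.range L,
        ‖charTransform (digitLaw q) ((p : ℝ) ^ i * m)‖ ≤ ρ ^ n := by
      intro i _
      obtain ⟨s, hs, hsk⟩ := exists_finset_le_norm hp hL i m
      have hcard : n ≤ s.card :=
        Nat.le_of_mul_le_mul_left (Nat.le_of_mul_le_mul_left (hm.trans hs) three_pos) hL
      refine (norm_charTransform_digitLaw_le_pow q s fun k hk => ?_).trans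
        (pow_le_pow_of_le_one hρ0 hρ1.le hcard)
      refine (hqdecay _).trans ?_
      have := hr _ (hsk k hk)
      simp only [ρ]
      gcongr
    rw [hν, norm_mul, Complex.norm_real, Real.norm_of_nonneg (by positivity), one_div_mul_eq_div,
      div_lt_iff₀ hL']
    refine (norm_sum_le_of_le _ hterm).trans_lt ?_
    rw [Finset.sum_const, Finset.card_range, nsmul_eq_mul, mul_comm]
    gcongr

/-! ### Densities of sets of integers. -/

theorem proportion_le_proportion {A B : Set ℕ} {N : ℕ} (h : ∀ n ∈ Set.Icc 1 N, n ∈ A → n ∈ B) :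
    proportion A N ≤ proportion B N := by
  unfold proportion
  have : (A ∩ Set.Icc 1 N).ncard ≤ (B ∩ Set.Icc 1 N).ncard :=
    Set.ncard_le_ncard (fun n hn => ⟨h n hn.2 hn.1, hn.2⟩)
      ((Set.finite_Icc 1 N).subset Set.inter_subset_right)
  gcongr

theorem ncard_Icc_one (N : ℕ) : (Set.Icc 1 N).ncard = N := by
  rw [← Finset.coe_Icc, Set.ncard_coe_finset]
  simp

theorem proportion_le_one (A : Set ℕ) (N : ℕ) : proportion A N ≤ 1 := by
  refine div_le_one_of_le₀ ?_ (Nat.cast_nonneg N)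
  have := Set.ncard_le_ncard (Set.inter_subset_right (s := A)) (Set.finite_Icc 1 N)
  rw [ncard_Icc_one] at this
  exact_mod_cast this

theorem proportion_nonneg (A : Set ℕ) (N : ℕ) : 0 ≤ proportion A N := by
  unfold proportion
  positivity

theorem nonempty_of_proportion_pos {A : Set ℕ} {N : ℕ} (h : 0 < proportion A N) : A.Nonempty := by
  by_contra hA
  rw [Set.not_nonempty_iff_eq_empty.1 hA] at h
  simp [proportion] at h

theorem add_proportion_le (A B : Set ℕ) {N : ℕ} (hN : 0 < N) :
    proportion A N + proportion B N - 1 ≤ proportion (A ∩ B) N := by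
  have hN' : (0 : ℝ) < N := by exact_mod_cast hN
  have hfin : ∀ C : Set ℕ, (C ∩ Set.Icc 1 N).Finite := fun C =>
    (Set.finite_Icc 1 N).subset Set.inter_subset_right
  have h1 := Set.ncard_union_add_ncard_inter (A ∩ Set.Icc 1 N) (B ∩ Set.Icc 1 N) (hfin A) (hfin B)
  have h2 : ((A ∩ Set.Icc 1 N) ∪ (B ∩ Set.Icc 1 N)).ncard ≤ N := by
    conv_rhs => rw [← ncard_Icc_one N]
    exact Set.ncard_le_ncard (Set.union_subset Set.inter_subset_right Set.inter_subset_right)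
      (Set.finite_Icc 1 N)
  rw [← Set.inter_inter_distrib_right] at h1
  have h3 : ((A ∩ Set.Icc 1 N).ncard : ℝ) + (B ∩ Set.Icc 1 N).ncard - N ≤
      ((A ∩ B) ∩ Set.Icc 1 N).ncard := by
    have : (A ∩ Set.Icc 1 N).ncard + (B ∩ Set.Icc 1 N).ncard ≤
      N + ((A ∩ B) ∩ Set.Icc 1 N).ncard := by omega
    rw [sub_le_iff_le_add']
    exact_mod_cast this
  unfold proportion
  rw [← add_div, ← div_self hN'.ne', ← sub_div]
  gcongr

theorem HasDensityOne.mono {A B : Set ℕ} (hA : HasDensityOne A) (h : A ⊆ B) : HasDensityOne B :=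
  tendsto_of_tendsto_of_tendsto_of_le_of_le hA tendsto_const_nhds
    (fun _ => proportion_le_proportion fun _ _ hn => h hn) fun N => proportion_le_one B N

theorem HasDensityOne.inter {A B : Set ℕ} (hA : HasDensityOne A) (hB : HasDensityOne B) :
    HasDensityOne (A ∩ B) := by
  have h : Tendsto (fun N => proportion A N + proportion B N - 1) atTop (𝓝 1) := by
    simpa using (Tendsto.add hA hB).sub_const 1
  refine tendsto_of_tendsto_of_tendsto_of_le_of_le' h tendsto_const_nhds ?_
    (Eventually.of_forall fun N => proportion_le_one _ N)
  filter_upwards [eventually_gt_atTop 0] with N hN using add_proportion_le A B hN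

theorem hasDensityOne_univ : HasDensityOne Set.univ := by
  refine tendsto_const_nhds.congr' ?_
  filter_upwards [eventually_gt_atTop 0] with N hN
  rw [proportion, Set.univ_inter, ncard_Icc_one, div_self (by exact_mod_cast hN.ne')]

theorem hasDensityOne_biInter {ι : Type*} (s : Finset ι) {A : ι → Set ℕ}
    (h : ∀ i ∈ s, HasDensityOne (A i)) : HasDensityOne {n | ∀ i ∈ s, n ∈ A i} := by
  classical
  induction s using Finset.induction_on with
  | empty => simpa using hasDensityOne_univ
  | insert a s _ ih =>
    refine ((h a (Finset.mem_insert_self a s)).inter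
      (ih fun i hi => h i (Finset.mem_insert_of_mem hi))).mono fun n hn i hi => ?_
    rcases Finset.mem_insert.1 hi with rfl | hi
    exacts [hn.1, hn.2 i hi]

/-! ### Open dense sets and residuality. -/

theorem hasDensityOne_push_mem_fourierBox {p : ℕ} {c : ℕ → ℤ}
    (hc : ∀ a : ℤ, a ≠ 0 →
      TendstoInftyAlongDensityOne fun n => digitComplexity p (a * c n).natAbs)
    {ν : ProbabilityMeasure UnitAddCircle}
    (hν : ∀ η > 0, ∃ K, ∀ m : ℤ, K ≤ digitComplexity p m.natAbs → ‖fourierMass ν m‖ < η) (k : ℕ) :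
    HasDensityOne {n | push (c n) ν ∈ fourierBox leb k} := by
  refine hasDensityOne_biInter (Finset.Icc (-(k : ℤ)) k)
    (A := fun m => {n | ‖fourierMass (push (c n) ν) m - fourierMass leb m‖ < 1 / ((k : ℝ) + 1)})
    fun m _ => ?_
  rcases eq_or_ne m 0 with rfl | hm
  · refine hasDensityOne_univ.mono fun n _ => ?_
    simp only [Set.mem_ofPred_eq, fourierMass_zero, sub_self, norm_zero]
    positivity
  · obtain ⟨K, hK⟩ := hν (1 / ((k : ℝ) + 1)) (by positivity)
    refine (hc m hm K).mono fun n hn => ?_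
    rw [Set.mem_ofPred_eq, fourierMass_leb hm, sub_zero, fourierMass_push]
    exact hK _ hn

/-- The invariant measures `μ` for which, for some `N ≥ N₀`, all but a proportion `1 / (k + 1)` of
the measures `T_{c n} μ`, `1 ≤ n ≤ N`, are close to Lebesgue measure. -/
def nearLebOften (p : ℕ) (c : ℕ → ℤ) (k N₀ : ℕ) : Set (InvMeasure p) :=
  {μ | ∃ N ≥ N₀, 1 - 1 / ((k : ℝ) + 1) < proportion {n | push (c n) μ.1 ∈ fourierBox leb k} N}

theorem isOpen_nearLebOften (p : ℕ) (c : ℕ → ℤ) (k N₀ : ℕ) : IsOpen (nearLebOften p c k N₀) := by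
  refine isOpen_iff_mem_nhds.2 fun μ ⟨N, hN, hμ⟩ => ?_
  have h : ∀ᶠ ν : InvMeasure p in 𝓝 μ, ∀ n ∈ Set.Icc 1 N,
      push (c n) μ.1 ∈ fourierBox leb k → push (c n) ν.1 ∈ fourierBox leb k := by
    refine (Set.finite_Icc 1 N).eventually_all.2 fun n _ => ?_
    by_cases hn : push (c n) μ.1 ∈ fourierBox leb k
    · filter_upwards [((continuous_push (c n)).comp continuous_subtype_val).continuousAt
        ((isOpen_fourierBox leb k).mem_nhds hn)] with ν hν _ using hν
    · exact Eventually.of_forall fun ν h => absurd h hn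
  filter_upwards [h] with ν hν
  exact ⟨N, hN, hμ.trans_le (proportion_le_proportion hν)⟩

theorem dense_nearLebOften {p : ℕ} (hp : 2 ≤ p) {c : ℕ → ℤ}
    (hc : ∀ a : ℤ, a ≠ 0 →
      TendstoInftyAlongDensityOne fun n => digitComplexity p (a * c n).natAbs)
    (k N₀ : ℕ) : Dense (nearLebOften p c k N₀) := by
  refine fun μ => mem_closure_iff_nhds.2 fun U hU => ?_
  obtain ⟨V, hV, hVU⟩ := mem_nhds_subtype _ μ U |>.1 hU
  obtain ⟨l, hl⟩ := exists_fourierBox_subset hV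
  obtain ⟨ν, hνbox, hνinv, hνdecay⟩ := exists_mem_fourierBox hp μ.2 l
  have hden := hasDensityOne_push_mem_fourierBox hc hνdecay k
  have hlt : 1 - 1 / ((k : ℝ) + 1) < 1 := sub_lt_self _ (by positivity)
  obtain ⟨N, hN, hN₀⟩ :=
    ((Tendsto.eventually hden (lt_mem_nhds hlt)).and (eventually_ge_atTop N₀)).exists
  exact ⟨⟨ν, hνinv⟩, hVU (hl hνbox), N, hN₀, hN⟩

theorem mem_goodMeasures {p : ℕ} {c : ℕ → ℤ} {μ : InvMeasure p}
    (h : ∀ k N₀, μ ∈ nearLebOften p c k N₀) : μ ∈ goodMeasures p c := by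
  refine ⟨fun x => ?_, fun V hV => ?_⟩
  · by_contra hx
    obtain ⟨k, hk⟩ := exists_fourierBox_subset (eventually_forall_singleton_lt
      (pos_iff_ne_zero.2 hx))
    obtain ⟨N, -, hN⟩ := h k 0
    have h1 : 1 / ((k : ℝ) + 1) ≤ 1 :=
      (div_le_one (by positivity)).2 (by linarith [k.cast_nonneg (α := ℝ)])
    -- A single `n` with `T_{c n} μ` close enough to Lebesgue already excludes an atom at `x`.
    obtain ⟨n, hn⟩ := nonempty_of_proportion_pos (lt_of_le_of_lt (sub_nonneg.2 h1) hN)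
    exact absurd (singleton_le_push (c n) μ.1 x) (not_le.2 (hk hn _))
  · obtain ⟨k, hk⟩ := exists_fourierBox_subset hV
    have hbdd : IsBoundedUnder (· ≤ ·) atTop
        (proportion {n | push (c n) μ.1 ∈ V}) :=
      isBoundedUnder_of ⟨1, fun N => proportion_le_one _ N⟩
    have hcobdd : IsCoboundedUnder (· ≤ ·) atTop
        (proportion {n | push (c n) μ.1 ∈ V}) :=
      (isBoundedUnder_of ⟨0, fun N => proportion_nonneg _ N⟩ :
        IsBoundedUnder (· ≥ ·) atTop _).isCoboundedUnder_le
    refine le_antisymm (limsup_le_of_le hcobdd (Eventually.of_forall fun N => proportion_le_one _ N))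
      (le_of_forall_lt_imp_le_of_dense fun b hb => ?_)
    obtain ⟨j, hj⟩ := exists_nat_one_div_lt (sub_pos.2 hb)
    refine le_limsup_of_frequently_le (frequently_atTop.2 fun N₀ => ?_) hbdd
    -- The index `j` brings the proportion above `b`, while `k` brings the box inside `V`.
    obtain ⟨N, hN, hμ⟩ := h (max j k) N₀
    refine ⟨N, hN, ?_⟩
    have h1 : 1 / (((max j k : ℕ) : ℝ) + 1) ≤ 1 / ((j : ℝ) + 1) :=
      Nat.one_div_le_one_div (le_max_left j k)
    have h2 : proportion {n | push (c n) μ.1 ∈ fourierBox leb (max j k)} N ≤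
        proportion {n | push (c n) μ.1 ∈ V} N :=
      proportion_le_proportion fun n _ hn => hk (fourierBox_antitone leb (le_max_right j k) hn)
    linarith

end TimesP

end

theorem proposition5p12 (p : ℕ) (hp : 2 ≤ p) (c : ℕ → ℤ)
    (hc : ∀ a : ℤ, a ≠ 0 →
      TimesP.TendstoInftyAlongDensityOne
        fun n => TimesP.digitComplexity p (a * c n).natAbs) :
    TimesP.goodMeasures p c ∈ residual (TimesP.InvMeasure p) := by
  have h : ∀ᶠ μ in residual (TimesP.InvMeasure p), ∀ k N₀, μ ∈ TimesP.nearLebOften p c k N₀ :=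
    eventually_countable_forall.2 fun k => eventually_countable_forall.2 fun N₀ =>
      residual_of_dense_open (TimesP.isOpen_nearLebOften p c k N₀)
        (TimesP.dense_nearLebOften hp hc k N₀)
  exact h.mono fun μ hμ => TimesP.mem_goodMeasures hμ
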